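/- All structures are finite relational structures over a finite vocabulary $\tau$ (nullary symbols are allowed). For structures $\mathcal A$ (universe $A$, whose elements are called variables) and $\mathcal B$, and $X\subseteq A$, let $\mathcal A^{\mathcal B}[X]$ be the set of restrictions to $X$ of the homomorphisms from $\mathcal A$ to $\mathcal B$. A constraint of $\mathcal A$ is a pair $(R,t)$ with $R\in\tau$, $t\in R^{\mathcal A}$; its variables are the entries of $t$, and an assignment $u$ of values of $\mathcal B$ to (at least) these variables satisfies it if $u(t)\in R^{\mathcal B}$. *Views.* Let $k\ge 1$. The views of $tw_k$ are the sets $S\subseteq A$ with $|S|\le k$; put $\mathrm{var}(S)=S$, and let the relation of $S$ with respect to $\mathcal B$ consist of the assignments $S\to B$ that satisfy all constraints of $\mathcal A$ all of whose variables lie in $S$. The views of $hw_k$ are the sets $\mathcal C$ of at most $k$ constraints of $\mathcal A$; $\mathrm{var}(\mathcal C)$ is the set of variables occurring in $\mathcal C$, and the relation of $\mathcal C$ consists of the assignments $\mathrm{var}(\mathcal C)\to B$ that satisfy all constraints in $\mathcal C$. For ${\tt DM}\in\{tw_k,hw_k\}$ let $\mathcal A_{\mathcal V}=\ell\text{-}{\tt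 DM}(\mathcal A)$ be the resulting collection of views and $\mathcal B_{\mathcal V}=r\text{-}{\tt DM}(\mathcal A,\mathcal B)$ the family of their relations. ${\tt GAC}(\mathcal A_{\mathcal V},\mathcal B_{\mathcal V})$ is the largest family of subrelations of those in $\mathcal B_{\mathcal V}$ such that any two views have the same projection onto their common variables (for two views without common variables: both are empty or both are nonempty). Write $R^{{\tt GAC}}[O]$ for the set of restrictions to $O\subseteq\mathrm{var}(R)$ of the assignments that remain in the view $R$. *tp-coverings.* For a structure $\mathcal C$, a substructure is given by a subset of the universe and subsets of the relations (not necessarily induced). A core of $\mathcal C$ is a substructure $\mathcal C'$ to which $\mathcal C$ has a homomorphism, such that $\mathcal C$ has no homomorphism to a proper substructure of $\mathcal C'$. The hypergraph of a structure has as hyperedges the sets of variables of its constraints; the hypergraph of $\mathcal A_{\mathcal V}$ has as hyperedges the sets $\mathrm{var}(R)$ for all views $R$. Write $\mathcal H_1\le\mathcal H_2$ if each hyperedge of $\mathcal H_1$ is contained in one of $\mathcal H_2$. A hypergraph is acyclic if its hyperedges are the vertices of a tree (a join tree) in which, whenever a node lies in two hyperedges, it lies in every hyperedge on the path between them. The pair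 $(\mathcal H_1,\mathcal H_2)$ has a tree projection if $\mathcal H_1\le\mathcal H_a\le\mathcal H_2$ for some acyclic $\mathcal H_a$. A set $O=\{X_1,\dots,X_r\}\subseteq A$ is tp-covered in $\mathcal A_{\mathcal V}$ if the structure obtained from $\mathcal A$ by adding a fresh $r$-ary relation whose only tuple is $\langle X_1,\dots,X_r\rangle$ (the $X_i$ distinct) has a core $\mathcal A'$ such that the hypergraph of $\mathcal A'$ has a tree projection with respect to the hypergraph of $\mathcal A_{\mathcal V}$. **Theorem.** Let $k\ge 1$, let ${\tt DM}\in\{tw_k,hw_k\}$, let $\mathcal A$ be a finite structure and $\mathcal A_{\mathcal V}=\ell\text{-}{\tt DM}(\mathcal A)$, and let $O\subseteq A$ be a set of variables with $O\subseteq\mathrm{var}(R)$ for at least one view $R$ of $\mathcal A_{\mathcal V}$. The following are equivalent: 1. $O$ is tp-covered in $\mathcal A_{\mathcal V}$; 2. for every finite structure $\mathcal B$ over $\tau$ with nonempty universe and every view $R$ of $\mathcal A_{\mathcal V}$ with $O\subseteq\mathrm{var}(R)$, $$R^{{\tt GAC}(\mathcal A_{\mathcal V},\mathcal B_{\mathcal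 V})}[O]=\mathcal A^{\mathcal B}[O],\qquad\text{where }\mathcal B_{\mathcal V}=r\text{-}{\tt DM}(\mathcal A,\mathcal B).$$ -/

import Mathlib

universe u

namespace TreeProj

/-- A (relational) vocabulary: a type of relation symbols, each with an arity. -/
structure Vocabulary where
  /-- the relation symbols -/
  Sym : Type u
  /-- the arity of a symbol -/
  arity : Sym → ℕ

/-- A relational structure over `τ` whose universe is the type `U`. -/
structure RelStr (τ : Vocabulary.{u}) (U : Type u) where
  /-- the interpretation of a relation symbol -/
  rel : (R : τ.Sym) → Set (Fin (τ.arity R) → U)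

variable {τ : Vocabulary.{u}} {V D : Type u}

/-- `h` is a homomorphism from `A` to `B`. -/
def IsHom (A : RelStr τ V) (B : RelStr τ D) (h : V → D) : Prop :=
  ∀ (R : τ.Sym) (t : Fin (τ.arity R) → V), t ∈ A.rel R → (fun i => h (t i)) ∈ B.rel R

/-- `A^B[X]`: the restrictions to `X` of the homomorphisms from `A` to `B`. -/
def homRestrictions (A : RelStr τ V) (B : RelStr τ D) (X : Set V) : Set (X → D) :=
  {g | ∃ h : V → D, IsHom A B h ∧ g = fun x => h x.1}

/-! ## Substructures and cores -/

/-- A (not necessarily induced) substructure of `A`: a subset of the universe, together with a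
subset of each relation. -/
@[ext]
structure Substr (A : RelStr τ V) where
  /-- the universe of the substructure -/
  carrier : Set V
  /-- the relations of the substructure -/
  rel : (R : τ.Sym) → Set (Fin (τ.arity R) → V)
  rel_subset : ∀ R, rel R ⊆ A.rel R
  mem_carrier : ∀ R, ∀ t ∈ rel R, ∀ i, t i ∈ carrier

/-- A substructure of `A`, as a relational structure on its own universe. -/
def Substr.toRelStr {A : RelStr τ V} (S : Substr A) : RelStr τ S.carrier where
  rel R := {t | (fun i => (t i : V)) ∈ S.rel R}

/-- `S` is a substructure of `T`. -/
def Substr.IsSubstr {A : RelStr τ V} (S T : Substr A) : Prop :=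
  S.carrier ⊆ T.carrier ∧ ∀ R, S.rel R ⊆ T.rel R

/-- `S` is a core of `A`: there is a homomorphism from `A` to `S`, but none from `A` to a proper
substructure of `S`. -/
def IsCore (A : RelStr τ V) (S : Substr A) : Prop :=
  (∃ h, IsHom A S.toRelStr h) ∧
    ∀ T : Substr A, T.IsSubstr S → (∃ h, IsHom A T.toRelStr h) → T = S

/-! ## Hypergraphs and tree projections -/

/-- The hypergraph of a substructure: its nodes are the variables, and its hyperedges are the sets
of variables of the constraint scopes. -/
def Substr.hypergraph {A : RelStr τ V} (S : Substr A) : Hypergraph V where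
  vertexSet := S.carrier
  edgeSet := {e | ∃ R, ∃ t ∈ S.rel R, e = Set.range t}
  subset_vertexSet_of_mem_edgeSet' := by
    rintro e ⟨R, t, ht, rfl⟩ x ⟨i, rfl⟩
    exact S.mem_carrier R t ht i

/-- `T` is a join tree of `H`: a tree whose vertices are the hyperedges of `H` such that a node
occurring in two hyperedges occurs in every vertex of the path between them.  (A tree is a graph
that is acyclic and any two vertices of which are linked; the graph without vertices is allowed,
for a hypergraph without hyperedges.) -/
def IsJoinTree (H : Hypergraph V) (T : SimpleGraph H.edgeSet) : Prop :=
  T.IsAcyclic ∧ T.Preconnected ∧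
    ∀ (x : V) (e f : H.edgeSet), x ∈ (e : Set V) → x ∈ (f : Set V) →
      ∀ p : T.Walk e f, p.IsPath → ∀ g ∈ p.support, x ∈ (g : Set V)

/-- A hypergraph is acyclic if it has a join tree. -/
def HypergraphAcyclic (H : Hypergraph V) : Prop :=
  ∃ T : SimpleGraph H.edgeSet, IsJoinTree H T

/-- `H₁ ≤ H₂`: every hyperedge of `H₁` is contained in a hyperedge of `H₂`. -/
def HypergraphLE (H₁ H₂ : Hypergraph V) : Prop :=
  ∀ e ∈ H₁.edgeSet, ∃ f ∈ H₂.edgeSet, e ⊆ f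

/-- The pair `(H₁, H₂)` has a tree projection. -/
def HasTreeProjection (H₁ H₂ : Hypergraph V) : Prop :=
  ∃ Ha : Hypergraph V, HypergraphAcyclic Ha ∧ HypergraphLE H₁ Ha ∧ HypergraphLE Ha H₂

/-! ## Views and generalized arc consistency -/

/-- A view structure with universe `V`.  Each view `R` is interpreted by one tuple, listing the
variables of the set `var R`. -/
structure ViewStr (V : Type u) where
  /-- the views -/
  Sym : Type u
  /-- the variables of a view -/
  var : Sym → Set V

/-- The hypergraph of a view structure. -/
def ViewStr.hypergraph (W : ViewStr V) : Hypergraph V where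
  vertexSet := Set.univ
  edgeSet := Set.range W.var
  subset_vertexSet_of_mem_edgeSet' := fun e _ => Set.subset_univ e

/-- A right-hand structure over the vocabulary of views, with values in `D`: as `R` has a single
scope, that lists `var R`, the tuples of its relation are the assignments `var R → D`. -/
def ViewRel (W : ViewStr V) (D : Type u) : Type u :=
  (R : W.Sym) → Set (W.var R → D)

/-- The restrictions to `X ⊆ S` of the assignments in `Q`. -/
def restrictTo {S X : Set V} (Q : Set (S → D)) (hX : X ⊆ S) : Set (X → D) :=
  (fun u x => u (Set.inclusion hX x)) '' Q

/-- Any two views agree on their common variables: they allow the same assignments to them.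
For two views without common variables this says that both are empty or both are nonempty. -/
def PairwiseConsistent {W : ViewStr V} (Q : ViewRel W D) : Prop :=
  ∀ R R' : W.Sym,
    restrictTo (X := W.var R ∩ W.var R') (Q R) Set.inter_subset_left =
      restrictTo (X := W.var R ∩ W.var R') (Q R') Set.inter_subset_right

/-- `GAC(A_V, B_V)`: the largest family of subrelations of those of `B_V` that is pairwise
consistent, that is, what is left once tuples have been filtered out until any two views agree on
their common variables. -/
def GAC {W : ViewStr V} (BV : ViewRel W D) : ViewRel W D :=
  fun R => {u | ∃ Q : ViewRel W D, (∀ R', Q R' ⊆ BV R') ∧ PairwiseConsistent Q ∧ u ∈ Q R}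

theorem GAC_subset {W : ViewStr V} (BV : ViewRel W D) (R : W.Sym) : GAC BV R ⊆ BV R := by
  rintro u ⟨Q, hQ, -, hu⟩
  exact hQ R hu

theorem subset_GAC {W : ViewStr V} (BV Q : ViewRel W D) (hQ : ∀ R, Q R ⊆ BV R)
    (hc : PairwiseConsistent Q) (R : W.Sym) : Q R ⊆ GAC BV R :=
  fun _ hu => ⟨Q, hQ, hc, hu⟩

theorem GAC_pairwiseConsistent {W : ViewStr V} (BV : ViewRel W D) :
    PairwiseConsistent (GAC BV) := by
  intro R R'
  apply Set.Subset.antisymm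
  · rintro g ⟨u, ⟨Q, hQ, hc, hu⟩, rfl⟩
    have h := Set.mem_image_of_mem
      (fun (u : W.var R → D) (x : ↑(W.var R ∩ W.var R')) =>
        u (Set.inclusion Set.inter_subset_left x)) hu
    have h2 := (hc R R').subset h
    obtain ⟨w, hw, hwu⟩ := h2
    exact ⟨w, ⟨Q, hQ, hc, hw⟩, hwu⟩
  · rintro g ⟨u, ⟨Q, hQ, hc, hu⟩, rfl⟩
    have h := Set.mem_image_of_mem
      (fun (u : W.var R' → D) (x : ↑(W.var R ∩ W.var R')) =>
        u (Set.inclusion Set.inter_subset_right x)) hu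
    have h2 := (hc R R').superset h
    obtain ⟨w, hw, hwu⟩ := h2
    exact ⟨w, ⟨Q, hQ, hc, hw⟩, hwu⟩

/-! ## The decomposition methods `tw_k` and `hw_k` -/

/-- A constraint of `A`: a relation symbol with a scope, that is, a tuple of its relation. -/
structure Constr (A : RelStr τ V) where
  /-- the relation symbol -/
  sym : τ.Sym
  /-- the constraint scope -/
  scope : Fin (τ.arity sym) → V
  mem : scope ∈ A.rel sym

/-- The variables of a constraint. -/
def Constr.vars {A : RelStr τ V} (c : Constr A) : Set V := Set.range c.scope

/-- The assignment `u` of the variables in `S` satisfies the constraint `c`, all of whose variables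
are in `S`. -/
def Constr.Sat {A : RelStr τ V} (c : Constr A) (B : RelStr τ D) {S : Set V} (hc : c.vars ⊆ S)
    (u : S → D) : Prop :=
  (fun i => u ⟨c.scope i, hc (Set.mem_range_self i)⟩) ∈ B.rel c.sym

/-- The views of `tw_k`: one for each set of at most `k` variables. -/
def twViews (k : ℕ) (_A : RelStr τ V) : ViewStr V where
  Sym := {S : Set V // S.Finite ∧ S.ncard ≤ k}
  var S := S.1

/-- The relations of `tw_k`: the assignments to the set of variables that satisfy every constraint
all of whose variables are in the set. -/
def twRel (k : ℕ) (A : RelStr τ V) (B : RelStr τ D) : ViewRel (twViews k A) D :=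
  fun S => {u | ∀ (c : Constr A) (hc : c.vars ⊆ S.1), c.Sat B hc u}

/-- The variables that occur in a set of constraints. -/
def varsOf {A : RelStr τ V} (C : Set (Constr A)) : Set V := ⋃ c ∈ C, c.vars

/-- The views of `hw_k`: one for each set of at most `k` constraints. -/
def hwViews (k : ℕ) (A : RelStr τ V) : ViewStr V where
  Sym := {C : Set (Constr A) // C.Finite ∧ C.ncard ≤ k}
  var C := varsOf C.1

/-- The relations of `hw_k`: the assignments to the variables of the set of constraints that
satisfy every constraint in the set. -/
def hwRel (k : ℕ) (A : RelStr τ V) (B : RelStr τ D) : ViewRel (hwViews k A) D :=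
  fun C => {u | ∀ (c : Constr A) (hc : c ∈ C.1),
    c.Sat B (S := varsOf C.1) (Set.subset_biUnion_of_mem (u := Constr.vars) hc) u}

/-- The two decomposition methods. -/
inductive Method where
  /-- tree decompositions -/
  | tw : Method
  /-- generalized hypertree decompositions -/
  | hw : Method

/-- `ℓ-DM(A)`. -/
def viewsOf (M : Method) (k : ℕ) (A : RelStr τ V) : ViewStr V :=
  match M with
  | .tw => twViews k A
  | .hw => hwViews k A

/-- `r-DM(A, B)`. -/
def viewRelOf (M : Method) (k : ℕ) (A : RelStr τ V) (B : RelStr τ D) :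
    ViewRel (viewsOf M k A) D :=
  match M with
  | .tw => twRel k A B
  | .hw => hwRel k A B

/-! ## tp-covered sets of variables -/

/-- The vocabulary `τ` with a fresh `r`-ary relation symbol `none`. -/
def Vocabulary.addSym (τ : Vocabulary.{u}) (r : ℕ) : Vocabulary.{u} where
  Sym := Option τ.Sym
  arity
    | some R => τ.arity R
    | none => r

/-- `A ⊎ S_O`: the structure `A` with a fresh relation that holds exactly one tuple, which lists
the elements of `O` without repetition (the order is immaterial). -/
noncomputable def RelStr.addOutput [Finite V] (A : RelStr τ V) (O : Set V) :
    RelStr (τ.addSym (Nat.card O)) V where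
  rel
    | some R => A.rel R
    | none => {fun i : Fin (Nat.card O) => ((Finite.equivFin O).symm i : V)}

/-- `O` is tp-covered in the view structure `W` of `A`: some core of `A ⊎ S_O` has a hypergraph
with a tree projection with respect to the hypergraph of `W`. -/
def TPCovered [Finite V] (A : RelStr τ V) (W : ViewStr V) (O : Set V) : Prop :=
  ∃ S : Substr (A.addOutput O),
    IsCore (A.addOutput O) S ∧ HasTreeProjection S.hypergraph W.hypergraph

end TreeProj

/-! Restrictions of homomorphisms always survive `GAC`, so the theorem concerns only the inclusion
of the surviving assignments in `homRestrictions`.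

Given a tree projection of a core, label each hyperedge of the acyclic hypergraph with a view
containing it. Pairwise consistency carries a surviving assignment from a hyperedge containing `O`
along the join tree (`exists_tree_choice`), the running intersection property glues the local
choices, and composition with the homomorphism to the core, which fixes `O`, gives a homomorphism on
all of `A`.

For the converse, test condition 2 on one finite structure, `unfolding`, a truncation of a tree-like
cover of `A`. A `Bag` is a copy of a set of variables inside a view. Each element carries a name
that records its colour and, recursively, the bag into which it was born. Bags restrict and extend
freely, so they survive `GAC` (`bag_mem_GAC`), and condition 2 yields a homomorphism `h` from `A` to
the unfolding that agrees with a bag on `O`. Its first component is an endomorphism of `A` fixing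
`O`; by `exists_core_fixed` it can be precomposed to become the identity on a core. Then each tuple
of the core lies over itself in some bag, with globally consistent names.

These names give an elimination order (`exists_acyclic_of_bags`): some variable is the youngest in
every hyperedge containing it, and its neighbours all lie in its birth bag, hence with it in one
view. Names are cut off to keep the structure finite. Fresh colours exclude cycles of age that the
cut-off could otherwise allow, and each elimination costs one level of depth. -/

namespace TreeProj

/-! ### Join trees: attaching a leaf, propagating choices -/

section Trees

open SimpleGraph

/-- An injective image of an acyclic graph is acyclic. -/
theorem isAcyclic_map {α β : Type*} {G : SimpleGraph α} (f : α ↪ β) (r : β → α)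
    (hr : ∀ a, r (f a) = a) (hG : G.IsAcyclic) : (G.map f).IsAcyclic := by
  rw [isAcyclic_iff_forall_adj_isBridge] at hG ⊢
  rintro _ _ ⟨-, a, b, hab, rfl, rfl⟩
  have h := hG hab
  rw [isBridge_iff] at h ⊢
  refine fun hreach => h ?_
  have key : ∀ x y, ((G.map f).deleteEdges {s(f a, f b)}).Adj x y →
      (G.deleteEdges {s(a, b)}).Adj (r x) (r y) := by
    intro x y hxy
    rw [deleteEdges_adj] at hxy ⊢
    obtain ⟨⟨-, c, d, hcd, rfl, rfl⟩, hne⟩ := hxy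
    rw [hr, hr]
    refine ⟨hcd, fun h' => hne ?_⟩
    have := congrArg (Sym2.map f) (Set.mem_singleton_iff.1 h')
    simpa using this
  have := hreach.map (⟨r, fun {x y} hxy => key x y hxy⟩ : _ →g G.deleteEdges {s(a, b)})
  simpa [hr] using this

/-- In an acyclic graph, a node set whose members are linked within the set contains every path
between them. -/
theorem path_support_of_walk {α : Type*} {G : SimpleGraph α} (hG : G.IsAcyclic) {P : α → Prop}
    {a b : α} (h : ∃ w : G.Walk a b, ∀ c ∈ w.support, P c) (p : G.Walk a b) (hp : p.IsPath) :
    ∀ c ∈ p.support, P c := by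
  classical
  obtain ⟨w, hw⟩ := h
  have e : (⟨p, hp⟩ : G.Path a b) = w.toPath := (hG.subsingleton_path a b).elim _ _
  have e' : p = w.bypass := congrArg Subtype.val e
  intro c hc
  rw [e'] at hc
  exact hw c (w.support_bypass_subset_support hc)

/-- Attaching a hyperedge `L` that meets the union of the others inside a hyperedge `e` keeps a
hypergraph acyclic. -/
theorem HypergraphAcyclic.insert_edge {V : Type u} {H H' : Hypergraph V} (hH : HypergraphAcyclic H)
    {e L : Set V} (he : e ∈ H.edgeSet) (hL : L ∉ H.edgeSet)
    (hH' : H'.edgeSet = insert L H.edgeSet)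
    (hmeet : ∀ f ∈ H.edgeSet, L ∩ f ⊆ e) : HypergraphAcyclic H' := by
  classical
  obtain ⟨T, hac, hcon, hpath⟩ := hH
  have hsub : ∀ {f}, f ∈ H.edgeSet → f ∈ H'.edgeSet := fun h => by rw [hH']; exact Or.inr h
  have hL' : L ∈ H'.edgeSet := by rw [hH']; exact Or.inl rfl
  let ι : H.edgeSet ↪ H'.edgeSet := ⟨fun f => ⟨f.1, hsub f.2⟩, fun a b hab => by
    simpa [Subtype.ext_iff] using hab⟩
  let r : H'.edgeSet → H.edgeSet := fun f => if h : f.1 ∈ H.edgeSet then ⟨f.1, h⟩ else ⟨e, he⟩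
  have hr : ∀ a, r (ι a) = a := fun a => dif_pos a.2
  have hac0 := isAcyclic_map ι r hr hac
  let l : H'.edgeSet := ⟨L, hL'⟩
  let e' : H'.edgeSet := ι ⟨e, he⟩
  have hle : l ≠ e' := fun h => hL (by
    have : L = e := congrArg Subtype.val h
    rw [this]; exact he)
  -- As `L` is new, `l` is isolated in the image of `T`, so the edge to `e'` closes no cycle.
  have hnr : ¬ (T.map ι).Reachable l e' := by
    rintro ⟨w⟩
    rcases w.exists_eq_cons_of_ne hle with ⟨_, ⟨-, c, d, -, hc, -⟩, -⟩
    have hcL : c.1 = L := congrArg Subtype.val hc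
    exact hL (hcL ▸ c.2)
  let T' := T.map ι ⊔ edge l e'
  have hac' : T'.IsAcyclic := hac0.sup_edge_of_not_reachable hnr
  have hadj : T'.Adj l e' := by
    simp only [T', sup_adj]
    exact Or.inr ((edge_adj l e' l e').2 ⟨Or.inl ⟨rfl, rfl⟩, hle⟩)
  let φ : T →g T' := ⟨ι, fun {a b} hab => by
    simp only [T', sup_adj]
    exact Or.inl ⟨ι.injective.ne hab.ne, a, b, hab, rfl, rfl⟩⟩
  have cases' : ∀ a : H'.edgeSet, a = l ∨ ∃ b, a = ι b := by
    rintro ⟨a, ha⟩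
    have ha' := ha
    rw [hH'] at ha'
    rcases ha' with rfl | h
    · exact Or.inl rfl
    · exact Or.inr ⟨⟨a, h⟩, rfl⟩
  have walkTo : ∀ (x : V) (a : H.edgeSet), x ∈ L → x ∈ a.1 →
      ∃ w : T'.Walk l (ι a), ∀ c ∈ w.support, x ∈ c.1 := by
    intro x a hxL hxa
    have hxe : x ∈ e := hmeet a.1 a.2 ⟨hxL, hxa⟩
    obtain ⟨p, hp⟩ := (hcon ⟨e, he⟩ a).exists_isPath
    have hs := hpath x ⟨e, he⟩ a hxe hxa p hp
    refine ⟨Walk.cons hadj (p.map φ), ?_⟩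
    intro c hc
    rw [Walk.support_cons, List.mem_cons] at hc
    rcases hc with rfl | hc
    · exact hxL
    · rw [Walk.support_map, List.mem_map] at hc
      obtain ⟨d, hd, rfl⟩ := hc
      exact hs d hd
  refine ⟨T', hac', ?_, ?_⟩
  · have hreach : ∀ a : H'.edgeSet, T'.Reachable e' a := by
      intro a
      rcases cases' a with rfl | ⟨b, rfl⟩
      · exact hadj.symm.reachable
      · exact (hcon ⟨e, he⟩ b).map φ
    exact fun a b => (hreach a).symm.trans (hreach b)
  · intro x a b hxa hxb p hp
    refine path_support_of_walk (P := fun c => x ∈ c.1) hac' ?_ p hp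
    rcases cases' a with rfl | ⟨a, rfl⟩
    · rcases cases' b with rfl | ⟨b, rfl⟩
      · exact ⟨Walk.nil, fun c hc => by
          rw [Walk.support_nil, List.mem_singleton] at hc
          rw [hc]; exact hxa⟩
      · exact walkTo x b hxa hxb
    · rcases cases' b with rfl | ⟨b, rfl⟩
      · obtain ⟨w, hw⟩ := walkTo x a hxb hxa
        exact ⟨w.reverse, fun c hc => hw c (by simpa using hc)⟩
      · obtain ⟨p, hp⟩ := (hcon a b).exists_isPath
        have hs := hpath x a b hxa hxb p hp
        refine ⟨p.map φ, fun c hc => ?_⟩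
        rw [Walk.support_map, List.mem_map] at hc
        obtain ⟨d, hd, rfl⟩ := hc
        exact hs d hd

/-- A hypergraph with exactly one hyperedge is acyclic. -/
theorem HypergraphAcyclic.of_singleton {V : Type u} {H : Hypergraph V} {e : Set V}
    (he : H.edgeSet = {e}) : HypergraphAcyclic H := by
  have hall : ∀ a : H.edgeSet, a.1 = e := fun a => by
    exact he.subset a.2
  have : Subsingleton H.edgeSet := ⟨fun a b => Subtype.ext ((hall a).trans (hall b).symm)⟩
  refine ⟨⊥, isAcyclic_bot, fun a b => by rw [Subsingleton.elim a b], ?_⟩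
  intro x a b hxa _ p _ c _
  rwa [Subsingleton.elim c a]

/-- Along a tree, a choice at one node extends to a choice at all nodes that is compatible along
each edge. -/
theorem exists_tree_choice {ι α : Type*} {T : SimpleGraph ι} (hac : T.IsAcyclic)
    (hcon : T.Preconnected) (G : ι → Set α) (ρ : ι → ι → α → α → Prop)
    (hsymm : ∀ i j a b, ρ i j a b → ρ j i b a)
    (hext : ∀ i j, ∀ a ∈ G i, ∃ b ∈ G j, ρ i j a b) (r : ι) (a : α) (ha : a ∈ G r) :
    ∃ F : ι → α, F r = a ∧ (∀ i, F i ∈ G i) ∧ ∀ i j, T.Adj i j → ρ i j (F i) (F j) := by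
  classical
  choose! n hn using hext
  -- `W w` transports `a` back along `w`, one extension per edge; it is meaningful only for walks
  -- ending at the root `r`.
  let W : ∀ {i s : ι}, T.Walk i s → α := fun w =>
    Walk.rec (motive := fun i j _ => α) (fun {_} => a) (fun {i j _} _ _ b => n j i b) w
  have Wcons : ∀ {i j} (h : T.Adj i j) (w : T.Walk j r), W (Walk.cons h w) = n j i (W w) :=
    fun _ _ => rfl
  have WG : ∀ {i s : ι} (w : T.Walk i s), s = r → W w ∈ G i := by
    intro i s w
    induction w with
    | nil => rintro rfl; exact ha
    | cons h w ih => exact fun hs => (hn _ _ _ (ih hs)).1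
  choose p hp using fun i => (hcon i r).exists_isPath
  have huniq : ∀ {i} (q : T.Walk i r), q.IsPath → q = p i := fun {i} q hq =>
    congrArg Subtype.val ((hac.subsingleton_path i r).elim ⟨q, hq⟩ ⟨p i, hp i⟩)
  refine ⟨fun i => W (p i), ?_, fun i => WG _ rfl, ?_⟩
  · show W (p r) = a
    rw [← huniq (Walk.nil) Walk.IsPath.nil]
  -- Of two adjacent nodes, one has the root path of the other, lengthened by their edge. If each
  -- lay on the root path of the other, comparing lengths would make them equal.
  · have step : ∀ i j (h : T.Adj i j), i ∉ (p j).support → ρ i j (W (p i)) (W (p j)) := by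
      intro i j h hi
      rw [← huniq (Walk.cons h (p j)) ((Walk.cons_isPath_iff _ _).2 ⟨hp j, hi⟩), Wcons h]
      exact hsymm _ _ _ _ (hn j i _ (WG _ rfl)).2
    intro i j h
    by_cases hi : i ∈ (p j).support
    · refine hsymm _ _ _ _ (step j i h.symm fun hj => ?_)
      have e1 := huniq _ ((hp j).dropUntil hi)
      have e2 := huniq _ ((hp i).dropUntil hj)
      have l1 := congrArg Walk.length e1
      have l2 := congrArg Walk.length e2
      have t1 := congrArg Walk.length ((p j).take_spec hi)
      have t2 := congrArg Walk.length ((p i).take_spec hj)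
      rw [Walk.length_append] at t1 t2
      have : ((p j).takeUntil i hi).length = 0 := by omega
      exact h.ne (Walk.eq_of_length_eq_zero this).symm
    · exact step i j h hi

end Trees

/-! ### Surviving assignments and the direction from tp-coverings to `GAC` -/

section Views

variable {τ : Vocabulary.{u}} {V D : Type u}

/-- The relations of a decomposition method contain every assignment that satisfies all constraints
within the view. -/
theorem mem_viewRelOf (M : Method) (k : ℕ) (A : RelStr τ V) (B : RelStr τ D)
    (R : (viewsOf M k A).Sym) (u : (viewsOf M k A).var R → D)
    (hu : ∀ (c : Constr A) (hc : c.vars ⊆ (viewsOf M k A).var R), c.Sat B hc u) :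
    u ∈ viewRelOf M k A B R := by
  cases M with
  | tw => exact hu
  | hw => exact fun c hc => hu c (Set.subset_biUnion_of_mem (u := Constr.vars) hc)

/-- Two assignments that survive in two views can be matched on the common variables. -/
theorem GAC_exists_agree {W : ViewStr V} {BV : ViewRel W D} {R : W.Sym} {u : W.var R → D}
    (hu : u ∈ GAC BV R) (R' : W.Sym) :
    ∃ w ∈ GAC BV R', ∀ x (hx : x ∈ W.var R) (hx' : x ∈ W.var R'), w ⟨x, hx'⟩ = u ⟨x, hx⟩ := by
  obtain ⟨w, hw, hwu⟩ := (GAC_pairwiseConsistent BV R R').subset ⟨u, hu, rfl⟩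
  exact ⟨w, hw, fun x hx hx' => congrFun hwu ⟨x, hx, hx'⟩⟩

/-- What survives in a view satisfies every constraint within the view. -/
theorem sat_of_mem_GAC (M : Method) {k : ℕ} (hk : 1 ≤ k) (A : RelStr τ V) (B : RelStr τ D)
    (R : (viewsOf M k A).Sym) (u : (viewsOf M k A).var R → D)
    (hu : u ∈ GAC (viewRelOf M k A B) R)
    (c : Constr A) (hc : c.vars ⊆ (viewsOf M k A).var R) : c.Sat B hc u := by
  cases M with
  | tw => exact GAC_subset _ _ hu c hc
  | hw =>
    -- The constraint `c` need not belong to the set `R`; agreement with the singleton view of `c`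
    -- enforces it.
    let R' : (viewsOf .hw k A).Sym := ⟨{c}, Set.finite_singleton c, by simpa using hk⟩
    obtain ⟨w, hw, hwu⟩ := GAC_exists_agree hu R'
    have hs := GAC_subset _ _ hw c (Set.mem_singleton c)
    unfold Constr.Sat at hs ⊢
    convert! hs using 2 with i
    exact (hwu _ _ _).symm

/-- Restrictions of homomorphisms survive. -/
theorem hom_mem_GAC (M : Method) (k : ℕ) (A : RelStr τ V) (B : RelStr τ D) {h : V → D}
    (hh : IsHom A B h) (R : (viewsOf M k A).Sym) :
    (fun x => h x.1) ∈ GAC (viewRelOf M k A B) R := by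
  refine subset_GAC _ (fun R => {fun x : (viewsOf M k A).var R => h x.1}) ?_ ?_ R
    (Set.mem_singleton _)
  · rintro R _ rfl
    exact mem_viewRelOf M k A B R _ fun c _ => hh c.sym c.scope c.mem
  · intro R R'
    simp only [restrictTo, Set.image_singleton]

theorem homRestrictions_subset (M : Method) (k : ℕ) (A : RelStr τ V) (B : RelStr τ D) {O : Set V}
    (R : (viewsOf M k A).Sym) (hR : O ⊆ (viewsOf M k A).var R) :
    homRestrictions A B O ⊆ restrictTo (GAC (viewRelOf M k A B) R) hR := by
  rintro _ ⟨h, hh, rfl⟩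
  exact ⟨_, hom_mem_GAC M k A B hh R, rfl⟩

/-- The tuple that lists `O`. -/
noncomputable def outputTuple [Finite V] (O : Set V) : Fin (Nat.card O) → V :=
  fun i => ((Finite.equivFin O).symm i : V)

theorem range_outputTuple [Finite V] (O : Set V) : Set.range (outputTuple O) = O := by
  ext x
  constructor
  · rintro ⟨i, rfl⟩
    exact ((Finite.equivFin O).symm i).2
  · intro hx
    exact ⟨Finite.equivFin O ⟨x, hx⟩, congrArg Subtype.val (Equiv.symm_apply_apply _ _)⟩

theorem isHom_addOutput_iff [Finite V] {A : RelStr τ V} {O : Set V} {h : V → V} :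
    IsHom (A.addOutput O) (A.addOutput O) h ↔ IsHom A A h ∧ ∀ x ∈ O, h x = x := by
  constructor
  · refine fun hh => ⟨fun R t ht => hh (some R) t ht, fun x hx => ?_⟩
    have h1 : (fun i => h (outputTuple O i)) = outputTuple O := hh none (outputTuple O) rfl
    obtain ⟨i, rfl⟩ := (range_outputTuple O).superset hx
    exact congrFun h1 i
  · rintro ⟨hA, hO⟩ (_ | R) t ht
    · obtain rfl : t = outputTuple O := ht
      exact funext fun i => hO _ ((range_outputTuple O).subset ⟨i, rfl⟩)
    · exact hA R t ht

/-- A homomorphism to a substructure is a homomorphism to the structure. -/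
theorem IsHom.of_substr {A : RelStr τ V} {B : RelStr τ D} {S : Substr B} {h : V → S.carrier}
    (hh : IsHom A S.toRelStr h) : IsHom A B fun x => (h x : D) :=
  fun R t ht => S.rel_subset R (hh R t ht)

theorem restrictTo_GAC_subset_of_tpCovered [Finite V] [Nonempty D] (M : Method) {k : ℕ}
    (hk : 1 ≤ k) (A : RelStr τ V) (B : RelStr τ D) {O : Set V}
    (hcov : TPCovered A (viewsOf M k A) O)
    (R : (viewsOf M k A).Sym) (hR : O ⊆ (viewsOf M k A).var R) :
    restrictTo (GAC (viewRelOf M k A B) R) hR ⊆ homRestrictions A B O := by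
  classical
  rintro _ ⟨u, hu, rfl⟩
  obtain ⟨S, ⟨⟨h0, hh0⟩, -⟩, Ha, ⟨T, hac, hcon, hpath⟩, hS, hW⟩ := hcov
  have hfix := (isHom_addOutput_iff.1 hh0.of_substr).2
  choose ρ hρ using fun e : Ha.edgeSet => hW e.1 e.2
  choose hρ' hsub using hρ
  choose v hv using hρ'
  obtain rfl : (fun e => (viewsOf M k A).var (v e)) = ρ := funext hv
  -- The fresh tuple forces `O` into a hyperedge; even for empty `O` it provides a root for the join
  -- tree.
  obtain ⟨r, hr, hOr⟩ : ∃ r ∈ Ha.edgeSet, O ⊆ r := by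
    obtain ⟨r, hr, h⟩ := hS (Set.range fun i => (h0 (outputTuple O i) : V))
      ⟨none, _, hh0 none (outputTuple O) rfl, rfl⟩
    refine ⟨r, hr, fun x hx => h ?_⟩
    obtain ⟨i, rfl⟩ := (range_outputTuple O).superset hx
    exact ⟨i, hfix _ hx⟩
  let G : Ha.edgeSet → Set (V → D) := fun e =>
    {g | (fun x : (viewsOf M k A).var (v e) => g x) ∈ GAC (viewRelOf M k A B) (v e)}
  have total : ∀ (R : (viewsOf M k A).Sym) (w : (viewsOf M k A).var R → D), ∃ g : V → D,
      (fun x : (viewsOf M k A).var R => g x) = w := fun R w =>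
    ⟨fun x => if hx : x ∈ (viewsOf M k A).var R then w ⟨x, hx⟩ else Classical.arbitrary D,
      funext fun x => dif_pos x.2⟩
  obtain ⟨w0, hw0, hwu⟩ := GAC_exists_agree hu (v ⟨r, hr⟩)
  obtain ⟨g0, rfl⟩ := total _ w0
  obtain ⟨F, hF0, hFG, hFadj⟩ := exists_tree_choice hac hcon G
    (fun e f a b => ∀ x ∈ e.1, x ∈ f.1 → a x = b x)
    (fun e f a b hab x hx hx' => (hab x hx' hx).symm)
    (by
      intro e f a ha
      obtain ⟨w, hw, hwa⟩ := GAC_exists_agree ha (v f)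
      obtain ⟨g, rfl⟩ := total _ w
      exact ⟨g, hw, fun x hx hx' => (hwa x (hsub e hx) (hsub f hx')).symm⟩)
    ⟨r, hr⟩ g0 hw0
  have hwalk : ∀ (x : V) {e f : Ha.edgeSet} (p : T.Walk e f), (∀ g ∈ p.support, x ∈ g.1) →
      F e x = F f x := by
    intro x e f p
    induction p with
    | nil => exact fun _ => rfl
    | cons hadj p ih =>
      intro hp
      rw [← ih fun g hg => hp g (by simp [hg])]
      exact hFadj _ _ hadj x (hp _ (by simp)) (hp _ (by simp))
  have hagree : ∀ (x : V) (e f : Ha.edgeSet), x ∈ e.1 → x ∈ f.1 → F e x = F f x := by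
    intro x e f he hf
    obtain ⟨p, hp⟩ := (hcon e f).exists_isPath
    exact hwalk x p (hpath x e f he hf p hp)
  let g : V → D := fun x =>
    if hx : ∃ e : Ha.edgeSet, x ∈ e.1 then F hx.choose x else Classical.arbitrary D
  have hg : ∀ (e : Ha.edgeSet) x, x ∈ e.1 → g x = F e x := fun e x hx => by
    have hex : ∃ e : Ha.edgeSet, x ∈ e.1 := ⟨e, hx⟩
    simp only [g, dif_pos hex]
    exact hagree x _ _ hex.choose_spec hx
  refine ⟨fun x => g (h0 x), fun R t ht => ?_, funext fun x => ?_⟩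
  · have hmem := hh0 (some R) t ht
    obtain ⟨e, he, hte⟩ := hS _ ⟨some R, _, hmem, rfl⟩
    let c : Constr A := ⟨R, fun i => (h0 (t i) : V), S.rel_subset _ hmem⟩
    have hsat := sat_of_mem_GAC M hk A B _ _ (hFG ⟨e, he⟩) c (hte.trans (hsub ⟨e, he⟩))
    unfold Constr.Sat at hsat
    convert! hsat using 2 with i
    exact hg ⟨e, he⟩ _ (hte ⟨i, rfl⟩)
  · have hx := hOr x.2
    show u _ = g (h0 x)
    rw [hfix x x.2, hg ⟨r, hr⟩ x hx, hF0]
    exact (hwu x (hR x.2) (hsub ⟨r, hr⟩ hx)).symm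

end Views

/-! ### Bags, their names, and elimination of youngest variables -/

section Bags

variable {V : Type u} {C : Type}

/-- The variables to which a bag gives a name.  A name is a function `List V → Option C`: its value
at the empty list is the colour of the named element, and its value at `x :: l` is the value at `l`
of the name of the element for `x` in the bag into which the named element was born. -/
def bagDom (f : V → List V → Option C) : Set V := {x | f x [] ≠ none}

open Classical in
/-- The bags of a tree-like unfolding, in which each new element is named by its colour and the bag
to which it is added, and its colour does not occur in that bag up to depth `d`.  The domains of
bags are the sets with property `K`. -/
inductive Bag (K : Set V → Prop) (d : ℕ) : (V → List V → Option C) → Prop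
  | empty : Bag K d fun _ _ => none
  | restrict (f : V → List V → Option C) (X : Set V) :
      Bag K d f → Bag K d fun x => if x ∈ X then f x else fun _ => none
  | extend (f : V → List V → Option C) (y : V) (c : C) :
      Bag K d f → y ∉ bagDom f → K (insert y (bagDom f)) →
      (∀ x l, l.length + 1 ≤ d → f x l ≠ some c) →
      Bag K d (Function.update f y fun
        | [] => some c
        | x :: l => f x l)

variable {K : Set V → Prop} {d : ℕ} {f : V → List V → Option C}

theorem bagDom_restrict (f : V → List V → Option C) (X : Set V) [∀ x, Decidable (x ∈ X)] :
    bagDom (fun x => if x ∈ X then f x else fun _ => none) = bagDom f ∩ X := by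
  ext x
  by_cases hx : x ∈ X <;> simp [bagDom, hx]

theorem bagDom_update [DecidableEq V] (f : V → List V → Option C) (y : V)
    (p : List V → Option C) (hp : p [] ≠ none) :
    bagDom (Function.update f y p) = insert y (bagDom f) := by
  ext x
  by_cases hx : x = y
  · subst hx; simp [bagDom, hp]
  · simp [bagDom, hx]

/-- Of two elements of a bag, one was present when the other was added. -/
theorem Bag.comparable (hf : Bag K d f) {x y : V} (hx : x ∈ bagDom f) (hy : y ∈ bagDom f)
    (hxy : x ≠ y) : (∀ l, f y (x :: l) = f x l) ∨ ∀ l, f x (y :: l) = f y l := by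
  classical
  induction hf with
  | empty => exact absurd rfl hx
  | restrict f X hf ih =>
    rw [bagDom_restrict] at hx hy
    simpa [hx.2, hy.2] using ih hx.1 hy.1
  | extend f z c hf hz hK hc ih =>
    rw [bagDom_update _ _ _ (by simp)] at hx hy
    rcases hx with rfl | hx
    · right
      simp [hxy.symm]
    · rcases hy with rfl | hy
      · left
        simp [hxy]
      · have hxz : x ≠ z := fun h => hz (h ▸ hx)
        have hyz : y ≠ z := fun h => hz (h ▸ hy)
        simpa [hxz, hyz] using ih hx hy

/-- The bag to which an element was added. -/
theorem Bag.tail (hf : Bag K d f) {y : V} (hy : y ∈ bagDom f) :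
    Bag K d (fun x l => f y (x :: l)) ∧ K (insert y (bagDom fun x l => f y (x :: l))) := by
  classical
  induction hf with
  | empty => exact absurd rfl hy
  | restrict f X hf ih =>
    rw [bagDom_restrict] at hy
    simpa [hy.2] using ih hy.1
  | extend f z c hf hz hK hc ih =>
    rw [bagDom_update _ _ _ (by simp)] at hy
    by_cases hyz : y = z
    · subst hyz
      simpa using ⟨hf, hK⟩
    · simpa [hyz] using ih (hy.resolve_left hyz)

/-- The colour of an element differs from those in its history. -/
theorem Bag.fresh (hf : Bag K d f) {y : V} (hy : y ∈ bagDom f) {l : List V} (hl : l ≠ [])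
    (hld : l.length ≤ d) : f y l ≠ f y [] := by
  classical
  induction hf with
  | empty => exact absurd rfl hy
  | restrict f X hf ih =>
    rw [bagDom_restrict] at hy
    simpa [hy.2] using ih hy.1
  | extend f z c hf hz hK hc ih =>
    rw [bagDom_update _ _ _ (by simp)] at hy
    by_cases hyz : y = z
    · subst hyz
      obtain ⟨x, l, rfl⟩ := List.exists_cons_of_ne_nil hl
      simpa using hc x l hld
    · simpa [hyz] using ih (hy.resolve_left hyz)

/-- If there are more colours than paths of length at most `d`, each bag extends to each larger
set with property `K`. -/
theorem Bag.exists_extend [Finite V] [Finite C] (hK : ∀ X Y : Set V, X ⊆ Y → K Y → K X)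
    (hC : Nat.card {l : List V // l.length ≤ d} < Nat.card C) (hf : Bag K d f) {X : Set V}
    (hX : K X) (hfX : bagDom f ⊆ X) :
    ∃ f' : V → List V → Option C, Bag K d f' ∧ bagDom f' = X ∧ ∀ x ∈ bagDom f, f' x = f x := by
  classical
  have hfin : (X \ bagDom f).Finite := Set.toFinite _
  induction h : (X \ bagDom f).ncard generalizing f with
  | zero =>
    rw [Set.ncard_eq_zero hfin, Set.sdiff_eq_empty] at h
    exact ⟨f, hf, hfX.antisymm h, fun _ _ => rfl⟩
  | succ n ih =>
    obtain ⟨y, hyX, hy⟩ : (X \ bagDom f).Nonempty :=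
      (Set.ncard_pos hfin).1 (by omega)
    -- Each forbidden colour is read at some path `x :: l` of length at most `d`, and there are
    -- fewer such paths than colours.
    obtain ⟨c, hc⟩ : ∃ c : C, ∀ x l, l.length + 1 ≤ d → f x l ≠ some c := by
      by_contra! hcon
      choose x l hl hxl using hcon
      have : Finite {l : List V // l.length ≤ d} := (List.finite_length_le V d).to_subtype
      refine hC.not_ge (Nat.card_le_card_of_injective
        (fun c => (⟨x c :: l c, hl c⟩ : {l : List V // l.length ≤ d})) fun a b hab => ?_)
      have hab' := List.cons.inj (congrArg Subtype.val hab)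
      have h1 := hxl a
      rw [hab'.1, hab'.2, hxl b] at h1
      exact (Option.some.inj h1).symm
    have hsub : insert y (bagDom f) ⊆ X := Set.insert_subset hyX hfX
    have hg := Bag.extend f y c hf hy (hK _ _ hsub hX) hc
    have hdom := bagDom_update f y (fun | [] => some c | x :: l => f x l) (by simp)
    obtain ⟨f', hf', hd, hag⟩ := ih hg (by rw [hdom]; exact hsub) (Set.toFinite _) (by
      rw [hdom]
      have : X \ insert y (bagDom f) = (X \ bagDom f) \ {y} := by
        ext x; simp; tauto
      rw [this, Set.ncard_sdiff_singleton_of_mem (show y ∈ X \ bagDom f from ⟨hyX, hy⟩), h]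
      rfl)
    refine ⟨f', hf', hd, fun x hx => ?_⟩
    rw [hag x (by rw [hdom]; exact Or.inr hx), Function.update_of_ne (fun hxy : x = y => hy (hxy ▸ hx))]

/-- Elements whose colours do not occur in their histories cannot be cyclically older than each
other. -/
theorem not_cyclic_of_fresh {X : Finset V} (hX : X.Nonempty) {m : ℕ} (hm : X.card ≤ m)
    {h : V → List V → Option C}
    (hnext : ∀ y ∈ X, ∃ x ∈ X, ∀ l : List V, l.length + 1 ≤ m → h x (y :: l) = h y l)
    (hfresh : ∀ y ∈ X, ∀ l : List V, l ≠ [] → l.length ≤ m → h y l ≠ h y []) : False := by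
  classical
  choose! s hsX hs using hnext
  obtain ⟨y, hy⟩ := hX
  let a : ℕ → V := fun i => s^[i] y
  have asucc : ∀ i, a (i + 1) = s (a i) := fun i => Function.iterate_succ_apply' s i y
  have haX : ∀ i, a i ∈ X := by
    intro i
    induction i with
    | zero => exact hy
    | succ i ih => rw [asucc]; exact hsX _ ih
  -- Each iterate is younger than the one before, so the name of `a (i + n)` contains that of `a i`
  -- at depth `n`. A repetition puts a colour into its own history.
  have hpath : ∀ i n, ∃ l : List V, l.length = n ∧
      ∀ l' : List V, l'.length + n ≤ m → h (a (i + n)) (l ++ l') = h (a i) l' := by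
    intro i n
    induction n with
    | zero => exact ⟨[], rfl, fun _ _ => rfl⟩
    | succ n ih =>
      obtain ⟨l, hl, hl'⟩ := ih
      refine ⟨a (i + n) :: l, by simp [hl], fun l' hm => ?_⟩
      rw [← add_assoc, asucc, List.cons_append, hs _ (haX _) _ (by simp [hl]; omega),
        hl' l' (by omega)]
  obtain ⟨i, hi, j, hj, hij, hxy⟩ := Finset.exists_ne_map_eq_of_card_lt_of_maps_to
    (s := Finset.range (X.card + 1)) (t := X) (f := a) (by simp) (fun i _ => haX i)
  have main : ∀ i j, i < j → j ≤ X.card → a i ≠ a j := by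
    intro i j hij hj hxy
    obtain ⟨l, hl, hl'⟩ := hpath i (j - i)
    have h1 := hl' [] (by simp; omega)
    rw [show i + (j - i) = j by omega, List.append_nil, hxy] at h1
    exact hfresh _ (haX j) l (List.ne_nil_of_length_pos (by omega)) (by omega) h1
  rw [Finset.mem_range] at hi hj
  rcases hij.lt_or_gt with h | h
  · exact main i j h (by omega) hxy
  · exact main j i h (by omega) hxy.symm

/-- Hyperedges that look like bags, up to a depth not smaller than the number of nodes, are covered
by an acyclic hypergraph whose hyperedges have property `K`. -/
theorem exists_acyclic_of_bags (hK : ∀ X Y : Set V, X ⊆ Y → K Y → K X) (hK0 : K ∅) {m : ℕ}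
    (hmd : m ≤ d) (X : Finset V) (hX : X.card ≤ m) (h : V → List V → Option C)
    (E : Set (Set V)) (hEX : ∀ e ∈ E, e ⊆ X)
    (hE : ∀ e ∈ E, ∃ f : V → List V → Option C, Bag K d f ∧ e ⊆ bagDom f ∧
      ∀ x ∈ e, ∀ l : List V, l.length ≤ m → f x l = h x l) :
    ∃ Ha : Hypergraph V, HypergraphAcyclic Ha ∧ (∀ e ∈ E, ∃ f ∈ Ha.edgeSet, e ⊆ f) ∧
      ∀ f ∈ Ha.edgeSet, f ⊆ X ∧ K f := by
  classical
  induction m generalizing X E with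
  | zero =>
    obtain rfl : X = ∅ := Finset.card_eq_zero.1 (by omega)
    exact ⟨⟨Set.univ, {∅}, fun _ _ => Set.subset_univ _⟩, .of_singleton rfl,
      fun e he => ⟨∅, rfl, by simpa using hEX e he⟩,
      fun f hf => ⟨hf.subset.trans (Set.empty_subset _), hK _ _ hf.subset hK0⟩⟩
  | succ m ih =>
    rcases X.eq_empty_or_nonempty with rfl | hne
    · exact ih (by omega) ∅ (by simp) E hEX fun e he => by
        obtain ⟨f, hf, hd, hfh⟩ := hE e he
        exact ⟨f, hf, hd, fun x hx l hl => hfh x hx l (by omega)⟩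
    choose! F hF hdom hFh using hE
    -- `y` is the youngest element of every hyperedge through it; otherwise each node has a younger
    -- neighbour and age runs in a cycle.
    obtain ⟨y, hyX, hy⟩ : ∃ y ∈ X, ∀ e ∈ E, y ∈ e → ∀ x ∈ e, x ≠ y →
        ∀ l, F e y (x :: l) = F e x l := by
      by_contra! hcon
      refine not_cyclic_of_fresh hne hX (h := h) ?_ ?_
      · intro y hy
        obtain ⟨e, he, hye, x, hxe, hxy, l, hl⟩ := hcon y hy
        refine ⟨x, hEX e he hxe, fun l' hl' => ?_⟩
        rw [← hFh e he x hxe _ (by simpa using hl'), ← hFh e he y hye _ (by omega)]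
        exact ((hF e he).comparable (hdom e he hxe) (hdom e he hye) hxy).resolve_left
          (fun h' => hl (h' l)) l'
      · intro y hy l hl hlm
        obtain ⟨e, he, hye, -⟩ := hcon y hy
        rw [← hFh e he y hye _ hlm, ← hFh e he y hye _ (by simp)]
        exact (hF e he).fresh (hdom e he hye) hl (by omega)
    have hcard : (X.erase y).card ≤ m := by
      rw [Finset.card_erase_of_mem hyX]; omega
    by_cases hex : ∃ e ∈ E, y ∈ e
    · obtain ⟨e₀, he₀, hye₀⟩ := hex
      let N : Set V := {x | ∃ e ∈ E, y ∈ e ∧ x ∈ e}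
      have hNX : N ⊆ X := fun x ⟨e, he, _, hx⟩ => hEX e he hx
      obtain ⟨hg, hgK⟩ := (hF e₀ he₀).tail (hdom e₀ he₀ hye₀)
      -- All hyperedges through `y` see the same birth bag, since it is recorded in the name of `y`.
      -- Reading it uses the first letter of a path, so agreement drops from depth `m + 1` to `m`.
      have hgh : ∀ x ∈ N, x ≠ y → ∀ l : List V, l.length ≤ m → F e₀ y (x :: l) = h x l := by
        rintro x ⟨e, he, hye, hxe⟩ hxy l hl
        rw [hFh e₀ he₀ y hye₀ _ (by simpa using hl), ← hFh e he y hye _ (by simpa using hl),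
          hy e he hye x hxe hxy, hFh e he x hxe l (by omega)]
      have hNdom : ∀ x ∈ N, x ≠ y → x ∈ bagDom fun x l => F e₀ y (x :: l) := by
        intro x hxN hxy
        obtain ⟨e, he, hye, hxe⟩ := hxN
        show F e₀ y [x] ≠ none
        rw [hgh x ⟨e, he, hye, hxe⟩ hxy [] (by simp), ← hFh e he x hxe [] (by simp)]
        exact hdom e he hxe
      -- Eliminate `y`: its remaining neighbours become a hyperedge, witnessed by the birth bag.
      -- Afterwards `N` is attached as a leaf to a hyperedge covering them.
      obtain ⟨Ha, hac, hcov, hsub⟩ := ih (by omega) (X.erase y) hcard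
        (insert (N \ {y}) {e ∈ E | y ∉ e}) (by
          rintro e (rfl | ⟨he, hye⟩) x hx
          · exact Finset.mem_coe.2 (Finset.mem_erase.2 ⟨hx.2, hNX hx.1⟩)
          · exact Finset.mem_coe.2 (Finset.mem_erase.2 ⟨fun h => hye (h ▸ hx), hEX e he hx⟩))
        (by
          rintro e (rfl | ⟨he, hye⟩)
          · exact ⟨_, hg, fun x hx => hNdom x hx.1 hx.2, fun x hx => hgh x hx.1 hx.2⟩
          · exact ⟨F e, hF e he, hdom e he, fun x hx l hl => hFh e he x hx l (by omega)⟩)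
      obtain ⟨e₁, he₁, hNe₁⟩ := hcov _ (Set.mem_insert _ _)
      have hyf : ∀ f ∈ Ha.edgeSet, y ∉ f := fun f hf hyf =>
        Finset.notMem_erase y X ((hsub f hf).1 hyf)
      have hyN : y ∈ N := ⟨e₀, he₀, hye₀, hye₀⟩
      refine ⟨⟨Set.univ, insert N Ha.edgeSet, fun _ _ => Set.subset_univ _⟩,
        hac.insert_edge he₁ (fun hN => hyf N hN hyN) rfl ?_, ?_, ?_⟩
      · exact fun f hf x hx => hNe₁ ⟨hx.1, fun hxy => hyf f hf (hxy ▸ hx.2)⟩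
      · intro e he
        by_cases hye : y ∈ e
        · exact ⟨N, Or.inl rfl, fun x hx => ⟨e, he, hye, hx⟩⟩
        · obtain ⟨f, hf, hef⟩ := hcov e (Or.inr ⟨he, hye⟩)
          exact ⟨f, Or.inr hf, hef⟩
      · rintro f (rfl | hf)
        · refine ⟨hNX, hK _ _ (fun x hx => ?_) hgK⟩
          by_cases hxy : x = y
          · exact Or.inl hxy
          · exact Or.inr (hNdom x hx hxy)
        · exact ⟨(hsub f hf).1.trans (Finset.coe_subset.2 (Finset.erase_subset _ _)),
            (hsub f hf).2⟩
    · push Not at hex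
      obtain ⟨Ha, hac, hcov, hsub⟩ := ih (by omega) (X.erase y) hcard E
        (fun e he x hx => Finset.mem_coe.2 (Finset.mem_erase.2
          ⟨fun h => hex e he (h ▸ hx), hEX e he hx⟩))
        (fun e he => ⟨F e, hF e he, hdom e he, fun x hx l hl => hFh e he x hx l (by omega)⟩)
      exact ⟨Ha, hac, hcov, fun f hf =>
        ⟨(hsub f hf).1.trans (Finset.coe_subset.2 (Finset.erase_subset _ _)), (hsub f hf).2⟩⟩

end Bags

/-! ### Cores on which a given endomorphism becomes invertible -/

section Cores

variable {τ : Vocabulary.{u}} {V D : Type u}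

theorem IsHom.comp {U : Type u} {A : RelStr τ U} {B : RelStr τ V} {C : RelStr τ D} {g : V → D}
    {f : U → V} (hg : IsHom B C g) (hf : IsHom A B f) : IsHom A C (g ∘ f) :=
  fun R t ht => hg R _ (hf R t ht)

/-- For each endomorphism `e` there is an endomorphism `ψ` such that `e ∘ ψ` is the identity on
some core. -/
theorem exists_core_fixed [Finite V] (A : RelStr τ V) {e : V → V} (he : IsHom A A e) :
    ∃ ψ : V → V, IsHom A A ψ ∧ ∃ S : Substr A, IsCore A S ∧ ∀ x ∈ S.carrier, e (ψ x) = x := by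
  let P : Set (V → V) := {q | ∃ ψ, IsHom A A ψ ∧ q = e ∘ ψ}
  let img : (V → V) → Set V × ((R : τ.Sym) → Set (Fin (τ.arity R) → V)) := fun q =>
    (Set.range q, fun R => (fun t i => q (t i)) '' A.rel R)
  have hPhom : ∀ q ∈ P, IsHom A A q := by
    rintro _ ⟨ψ, hψ, rfl⟩
    exact he.comp hψ
  have hPcomp : ∀ q ∈ P, ∀ g, IsHom A A g → q ∘ g ∈ P := by
    rintro _ ⟨ψ, hψ, rfl⟩ g hg
    exact ⟨ψ ∘ g, hψ.comp hg, rfl⟩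
  -- `P` is the right ideal generated by `e`. Its members with image inside a minimal image form a
  -- finite semigroup, which has an idempotent `q`; the image of `q` is the core.
  obtain ⟨q₀, hq₀, hmin⟩ := (Set.toFinite P).exists_minimalFor img P
    ⟨e, id, fun R t ht => ht, rfl⟩
  obtain ⟨q, ⟨hqP, hqle⟩, hqq⟩ : ∃ q, (q ∈ P ∧ img q ≤ img q₀) ∧ q ∘ q = q := by
    let _ : TopologicalSpace (Function.End V) := ⊥
    have : DiscreteTopology (Function.End V) := ⟨rfl⟩
    have : Finite (Function.End V) := inferInstanceAs (Finite (V → V))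
    refine exists_idempotent_in_compact_subsemigroup (M := Function.End V)
      (fun _ => continuous_of_discreteTopology) {q | q ∈ P ∧ img q ≤ img q₀}
      ⟨q₀, hq₀, le_rfl⟩ (Set.toFinite _).isCompact ?_
    rintro q ⟨hq, hqle⟩ g ⟨hg, -⟩
    refine ⟨hPcomp q hq g (hPhom g hg), le_trans ⟨?_, fun R => ?_⟩ hqle⟩
    · exact Set.range_comp_subset_range g q
    · rintro _ ⟨t, ht, rfl⟩
      exact ⟨_, hPhom g hg R t ht, rfl⟩
  have hqmin : ∀ g ∈ P, img g ≤ img q → img q ≤ img g := fun g hg hgq =>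
    hqle.trans (hmin hg (hgq.trans hqle))
  let S : Substr A :=
    { carrier := Set.range q
      rel := fun R => (fun t i => q (t i)) '' A.rel R
      rel_subset := by
        rintro R _ ⟨t, ht, rfl⟩
        exact hPhom q hqP R t ht
      mem_carrier := by
        rintro R _ ⟨t, ht, rfl⟩ i
        exact ⟨_, rfl⟩ }
  have hfix : ∀ x ∈ S.carrier, q x = x := by
    rintro _ ⟨x, rfl⟩
    exact congrFun hqq x
  have hcore : IsCore A S := by
    refine ⟨⟨fun x => ⟨q x, x, rfl⟩, fun R t ht => ⟨t, ht, rfl⟩⟩, ?_⟩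
    rintro T ⟨hTc, hTr⟩ ⟨g, hg⟩
    -- Minimality holds only within `P`; `g` belongs to it because `q` fixes its values, so `g = q ∘
    -- g`.
    have hgP : (fun x => (g x : V)) ∈ P := by
      have h1 : q ∘ (fun x => (g x : V)) = fun x => (g x : V) :=
        funext fun x => hfix _ (hTc (g x).2)
      rw [← h1]
      exact hPcomp q hqP _ hg.of_substr
    have hgT : img (fun x => (g x : V)) ≤ (T.carrier, T.rel) := by
      refine ⟨?_, fun R => ?_⟩
      · rintro _ ⟨x, rfl⟩
        exact (g x).2
      · rintro _ ⟨t, ht, rfl⟩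
        exact hg R t ht
    have hST := (hqmin _ hgP (hgT.trans ⟨hTc, hTr⟩)).trans hgT
    exact Substr.ext (hTc.antisymm hST.1) (funext fun R => (hTr R).antisymm (hST.2 R))
  obtain ⟨ψ, hψ, rfl⟩ := hqP
  exact ⟨ψ, hψ, S, hcore, hfix⟩

end Cores

/-! ### The unfolding and the direction from `GAC` to tp-coverings -/

section Unfolding

variable {τ : Vocabulary.{u}} {V : Type u} {C : Type}

/-- The element for the variable `x` in the bag `f`, with its name cut off at depth `d`. -/
def bagElem (d : ℕ) (f : V → List V → Option C) (x : V) :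
    Option V × ({l : List V // l.length ≤ d} → Option C) :=
  (some x, fun l => f x l.1)

/-- The finite structure whose tuples are the copies of the tuples of `A` in the bags. -/
def unfolding (A : RelStr τ V) (K : Set V → Prop) (d : ℕ) (C : Type) :
    RelStr τ (Option V × ({l : List V // l.length ≤ d} → Option C)) where
  rel R := {s | ∃ t ∈ A.rel R, ∃ f : V → List V → Option C, Bag K d f ∧
    Set.range t ⊆ bagDom f ∧ s = fun i => bagElem d f (t i)}

/-- The assignments given by bags survive in the unfolding. -/
theorem bag_mem_GAC [Finite V] [Finite C] (M : Method) (k : ℕ) (A : RelStr τ V) {d : ℕ}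
    (hC : Nat.card {l : List V // l.length ≤ d} < Nat.card C) {f : V → List V → Option C}
    (hf : Bag (fun X => ∃ R, X ⊆ (viewsOf M k A).var R) d f) (R : (viewsOf M k A).Sym)
    (hd : bagDom f = (viewsOf M k A).var R) :
    (fun x : (viewsOf M k A).var R => bagElem d f x) ∈ GAC (viewRelOf M k A
      (unfolding A (fun X => ∃ R, X ⊆ (viewsOf M k A).var R) d C)) R := by
  classical
  set K : Set V → Prop := fun X => ∃ R, X ⊆ (viewsOf M k A).var R
  let Q : ViewRel (viewsOf M k A) (Option V × ({l : List V // l.length ≤ d} → Option C)) :=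
    fun R => {u | ∃ f : V → List V → Option C, Bag K d f ∧ bagDom f = (viewsOf M k A).var R ∧
      u = fun x : (viewsOf M k A).var R => bagElem d f x}
  have hK : ∀ X Y : Set V, X ⊆ Y → K Y → K X := fun X Y hXY ⟨R, hR⟩ => ⟨R, hXY.trans hR⟩
  have hmatch : ∀ (R R' : (viewsOf M k A).Sym), ∀ u ∈ Q R, ∃ w ∈ Q R',
      ∀ x (hx : x ∈ (viewsOf M k A).var R) (hx' : x ∈ (viewsOf M k A).var R'),
        w ⟨x, hx'⟩ = u ⟨x, hx⟩ := by
    rintro R R' _ ⟨f, hf, hd, rfl⟩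
    -- Forgetting the variables outside the second view keeps all names, histories included; the
    -- rest of that view is then born into this bag.
    have hr := hf.restrict _ ((viewsOf M k A).var R')
    have hrd := bagDom_restrict f ((viewsOf M k A).var R')
    obtain ⟨f', hf', hd', hag⟩ := hr.exists_extend hK hC (X := (viewsOf M k A).var R')
      ⟨R', subset_rfl⟩ (by rw [hrd]; exact Set.inter_subset_right)
    refine ⟨_, ⟨f', hf', hd', rfl⟩, fun x hx hx' => ?_⟩
    have := hag x (by rw [hrd, hd]; exact ⟨hx, hx'⟩)
    rw [if_pos hx'] at this
    simp only [bagElem, this]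
  refine subset_GAC _ Q ?_ ?_ R ⟨f, hf, hd, rfl⟩
  · rintro R _ ⟨f, hf, hd, rfl⟩
    exact mem_viewRelOf M k A _ R _ fun c hc =>
      ⟨c.scope, c.mem, f, hf, hc.trans hd.superset, rfl⟩
  · intro R R'
    apply Set.Subset.antisymm
    · rintro _ ⟨u, hu, rfl⟩
      obtain ⟨w, hw, hwu⟩ := hmatch R R' u hu
      exact ⟨w, hw, funext fun x => hwu x x.2.1 x.2.2⟩
    · rintro _ ⟨u, hu, rfl⟩
      obtain ⟨w, hw, hwu⟩ := hmatch R' R u hu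
      exact ⟨w, hw, funext fun x => hwu x x.2.2 x.2.1⟩

theorem tpCovered_of_forall_GAC [Finite V] (M : Method) (k : ℕ) (A : RelStr τ V) (O : Set V)
    (R : (viewsOf M k A).Sym) (hR : O ⊆ (viewsOf M k A).var R)
    (hGAC : ∀ (D : Type u) [Finite D] [Nonempty D] (B : RelStr τ D),
      restrictTo (GAC (viewRelOf M k A B) R) hR ⊆ homRestrictions A B O) :
    TPCovered A (viewsOf M k A) O := by
  classical
  have := Fintype.ofFinite V
  let K : Set V → Prop := fun X => ∃ R, X ⊆ (viewsOf M k A).var R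
  have hK : ∀ X Y : Set V, X ⊆ Y → K Y → K X := fun X Y hXY ⟨R, hR⟩ => ⟨R, hXY.trans hR⟩
  -- Elimination takes at most one level of names per variable, so this depth suffices.
  let d := Fintype.card V
  have hfin : Finite {l : List V // l.length ≤ d} := (List.finite_length_le V d).to_subtype
  let C := Fin (Nat.card {l : List V // l.length ≤ d} + 1)
  have hC : Nat.card {l : List V // l.length ≤ d} < Nat.card C := by simp [C]
  obtain ⟨f₀, hf₀, hd₀, -⟩ := (Bag.empty (K := K) (d := d) (C := C)).exists_extend hK hC
    (X := (viewsOf M k A).var R) ⟨R, subset_rfl⟩ (fun x hx => absurd rfl hx)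
  obtain ⟨h, hh, hhO⟩ := hGAC _ (unfolding A K d C) ⟨_, bag_mem_GAC M k A hC hf₀ R hd₀, rfl⟩
  have hhO : ∀ x ∈ O, h x = bagElem d f₀ x := fun x hx => (congrFun hhO ⟨x, hx⟩).symm
  -- The value `none` keeps the unfolding nonempty when `V` is empty. Only variables outside `O` and
  -- outside all constraints can be sent to it, so the default is harmless.
  let e : V → V := fun x => (h x).1.getD x
  have he : IsHom (A.addOutput O) (A.addOutput O) e := by
    refine isHom_addOutput_iff.2 ⟨fun R t ht => ?_, fun x hx => ?_⟩
    · obtain ⟨t', ht', f, -, -, heq⟩ := hh R t ht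
      have : (fun i => e (t i)) = t' := funext fun i => by
        have := congrFun heq i
        simp [e, this, bagElem]
      rwa [this]
    · simp [e, hhO x hx, bagElem]
  obtain ⟨ψ, hψ, S, hS, hfix⟩ := exists_core_fixed _ he
  obtain ⟨hψA, hψO⟩ := isHom_addOutput_iff.1 hψ
  obtain ⟨Ha, hac, hcov, hsub⟩ := exists_acyclic_of_bags (K := K) (C := C) hK
    ⟨R, Set.empty_subset _⟩ (le_refl d) Finset.univ le_rfl
    (fun x l => if hl : l.length ≤ d then (h (ψ x)).2 ⟨l, hl⟩ else none) S.hypergraph.edgeSet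
    (fun _ _ => by simp) (by
      rintro _ ⟨_ | R', t, ht, rfl⟩
      · obtain rfl : t = outputTuple O := S.rel_subset _ ht
        refine ⟨f₀, hf₀, ?_, ?_⟩
        · rw [hd₀]
          exact (range_outputTuple O).subset.trans hR
        · intro x hx l hl
          have hxO := (range_outputTuple O).subset hx
          rw [dif_pos hl, hψO x hxO, hhO x hxO]
          rfl
      · obtain ⟨t', -, f, hf, hd, heq⟩ := hh R' _ (hψA R' t (S.rel_subset _ ht))
        have heq : ∀ i, h (ψ (t i)) = bagElem d f (t' i) := congrFun heq
        -- The tuple `t'` lying below the image of `t` is `e ∘ ψ` applied to `t`, hence `t` itself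
        -- on the core.
        obtain rfl : t = t' := funext fun i => by
          rw [← hfix (t i) (S.mem_carrier _ t ht i)]
          simp [e, heq, bagElem]
        refine ⟨f, hf, hd, ?_⟩
        rintro _ ⟨i, rfl⟩ l hl
        rw [dif_pos hl, heq]
        rfl)
  refine ⟨S, hS, Ha, hac, hcov, fun f hf => ?_⟩
  obtain ⟨-, R', hR'⟩ := hsub f hf
  exact ⟨_, ⟨R', rfl⟩, hR'⟩

end Unfolding

end TreeProj

theorem mainTheorem6 {τ : TreeProj.Vocabulary.{u}} [Finite τ.Sym] {V : Type u} [Finite V]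
    (M : TreeProj.Method) (k : ℕ) (hk : 1 ≤ k) (A : TreeProj.RelStr τ V) (O : Set V)
    (hO : ∃ R : (TreeProj.viewsOf M k A).Sym, O ⊆ (TreeProj.viewsOf M k A).var R) :
    TreeProj.TPCovered A (TreeProj.viewsOf M k A) O ↔
      ∀ (D : Type u) [Finite D] [Nonempty D] (B : TreeProj.RelStr τ D)
        (R : (TreeProj.viewsOf M k A).Sym) (hR : O ⊆ (TreeProj.viewsOf M k A).var R),
        TreeProj.restrictTo (TreeProj.GAC (TreeProj.viewRelOf M k A B) R) hR =
          TreeProj.homRestrictions A B O := by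
  constructor
  · intro hcov D _ _ B R hR
    exact (TreeProj.restrictTo_GAC_subset_of_tpCovered M hk A B hcov R hR).antisymm
      (TreeProj.homRestrictions_subset M k A B R hR)
  · intro hGAC
    obtain ⟨R, hR⟩ := hO
    exact TreeProj.tpCovered_of_forall_GAC M k A O R hR fun D _ _ B => (hGAC D B R hR).subset
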